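/- Let $\mathbb D$ be the open unit disk and let $$B(z)=c\prod_{j=1}^n\frac{z-a_j}{1-\overline{a_j}z},\qquad |c|=1,\quad a_1,\dots,a_n\in\mathbb D,$$ be a finite Blaschke product of degree $n$ that is normalized, i.e. $B(0)=0$, $B'(0)>0$, and $B'(a)\neq 0$ whenever $a\in\mathbb D$ and $B(a)=0$. Let $S=\{z\in\mathbb D: B'(z)=0\}$ be its set of critical points, and assume that $B$ has exactly one critical value, i.e. $B(S)$ consists of a single point. Let $G_B$ be the monodromy group of $B$: the group of permutations of the branches of $B^{-1}$ at $0$ (germs $g$ at $0$ of holomorphic functions with $g(0)\in\mathbb D$ and $B\circ g=\mathrm{id}$ near $0$) that are induced by analytic continuation of these branches, through local inverses of $B$ with values in $\mathbb D$, along loops in $\mathbb D\setminus B(S)$ based at $0$. Then there are exactly $n$ branches, $G_B$ is a cyclic group of order $n$, and $G_B$ is generated by an $n$-cycle, i.e. by a permutation that permutes all $n$ branches in a single cycle. -/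

import Mathlib

open Filter Topology

/-- `B` is, on the open unit disk, a finite Blaschke product of degree `n`:
`B z = c * ∏ j, (z - a j) / (1 - conj (a j) * z)` with `|c| = 1` and all `a j` in the open disk. -/
def IsBlaschkeProduct (n : ℕ) (B : ℂ → ℂ) : Prop :=
  ∃ (c : ℂ) (a : Fin n → ℂ), ‖c‖ = 1 ∧ (∀ j, ‖a j‖ < 1) ∧
    ∀ z ∈ Metric.ball (0 : ℂ) 1,
      B z = c * ∏ j, (z - a j) / (1 - (starRingEnd ℂ) (a j) * z)

/-- The normalization: `B(0) = 0`, `B'(0) > 0`, and all zeros of `B` in the disk are simple. -/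
structure IsNormalized (B : ℂ → ℂ) : Prop where
  map_zero : B 0 = 0
  deriv_im : (deriv B 0).im = 0
  deriv_pos : 0 < (deriv B 0).re
  simple_zeros : ∀ a ∈ Metric.ball (0 : ℂ) 1, B a = 0 → deriv B a ≠ 0

/-- The critical points of `B` in the open unit disk. -/
def criticalPoints (B : ℂ → ℂ) : Set ℂ :=
  {z | z ∈ Metric.ball (0 : ℂ) 1 ∧ deriv B z = 0}

/-- The critical values of `B`: the images of the critical points in the open unit disk. -/
def criticalValues (B : ℂ → ℂ) : Set ℂ :=
  B '' criticalPoints B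

/-- `g` is near `w` a holomorphic right inverse of `B`, with value at `w` in the unit disk. -/
def IsLocalInverse (B : ℂ → ℂ) (w : ℂ) (g : ℂ → ℂ) : Prop :=
  AnalyticAt ℂ g w ∧ g w ∈ Metric.ball (0 : ℂ) 1 ∧ ∀ᶠ z in 𝓝 w, B (g z) = z

/-- The branches of `B⁻¹` at `0`: germs at `0` of holomorphic local inverses of `B`. -/
def Branch (B : ℂ → ℂ) : Type :=
  {φ : Germ (𝓝 (0 : ℂ)) ℂ // ∃ g : ℂ → ℂ, IsLocalInverse B 0 g ∧ φ = (g : Germ (𝓝 (0 : ℂ)) ℂ)}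

/-- `ψ` is obtained from the branch `φ` by analytic continuation, through local inverses of `B`,
along the loop `γ`: there are local inverses `G t` of `B` at `γ t` such that for `s` close to `t`
the functions `G s` and `G t` agree near `γ s`, and `G 0`, `G 1` represent `φ`, `ψ`. -/
def ContinuesAlong (B : ℂ → ℂ) (γ : Path (0 : ℂ) 0) (φ ψ : Branch B) : Prop :=
  ∃ G : unitInterval → ℂ → ℂ,
    (∀ t, IsLocalInverse B (γ t) (G t)) ∧
    (∀ t, ∀ᶠ s in 𝓝 t, G s =ᶠ[𝓝 (γ s)] G t) ∧
    φ.1 = (G 0 : Germ (𝓝 (0 : ℂ)) ℂ) ∧ ψ.1 = (G 1 : Germ (𝓝 (0 : ℂ)) ℂ)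

/-- The loop `γ` based at `0` stays in the unit disk and avoids the critical values of `B`. -/
def IsAdmissibleLoop (B : ℂ → ℂ) (γ : Path (0 : ℂ) 0) : Prop :=
  ∀ t, γ t ∈ Metric.ball (0 : ℂ) 1 \ criticalValues B

theorem ContinuesAlong.const {B : ℂ → ℂ} (φ : Branch B) :
    ContinuesAlong B (Path.refl 0) φ φ := by
  obtain ⟨g, hg, h⟩ := φ.2
  exact ⟨fun _ => g, fun t => by simpa using hg,
    fun t => Eventually.of_forall fun s => EventuallyEq.rfl, h, h⟩

theorem ContinuesAlong.reverse {B : ℂ → ℂ} {γ : Path (0 : ℂ) 0} {φ ψ : Branch B}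
    (h : ContinuesAlong B γ φ ψ) : ContinuesAlong B γ.symm ψ φ := by
  obtain ⟨G, h1, h2, h3, h4⟩ := h
  refine ⟨fun t => G (unitInterval.symm t), fun t => h1 _, fun t => ?_, ?_, ?_⟩
  · exact (unitInterval.continuous_symm.tendsto t).eventually (h2 (unitInterval.symm t))
  · simpa using h4
  · simpa using h3

theorem ContinuesAlong.concat {B : ℂ → ℂ} {δ γ : Path (0 : ℂ) 0} {φ ψ χ : Branch B}
    (h : ContinuesAlong B δ φ ψ) (h' : ContinuesAlong B γ ψ χ) :
    ContinuesAlong B (δ.trans γ) φ χ := by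
  obtain ⟨G, h1, h2, h3, h4⟩ := h
  obtain ⟨K, k1, k2, k3, k4⟩ := h'
  have hGK : G 1 =ᶠ[𝓝 (0 : ℂ)] K 0 := Germ.coe_eq.mp (h4.symm.trans k3)
  let p : unitInterval → unitInterval := fun t => Set.projIcc 0 1 zero_le_one (2 * (t : ℝ))
  let q : unitInterval → unitInterval := fun t => Set.projIcc 0 1 zero_le_one (2 * (t : ℝ) - 1)
  have hp : Continuous p := continuous_projIcc.comp (by fun_prop)
  have hq : Continuous q := continuous_projIcc.comp (by fun_prop)
  have hval : ∀ t : unitInterval,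
      (δ.trans γ) t = if (t : ℝ) ≤ 1 / 2 then δ (p t) else γ (q t) := fun t => rfl
  have hle : ∀ t : unitInterval, (t : ℝ) ≤ 1 / 2 → (δ.trans γ) t = δ (p t) := fun t ht => by
    rw [hval, if_pos ht]
  have hgt : ∀ t : unitInterval, ¬ (t : ℝ) ≤ 1 / 2 → (δ.trans γ) t = γ (q t) := fun t ht => by
    rw [hval, if_neg ht]
  refine ⟨fun t => if (t : ℝ) ≤ 1 / 2 then G (p t) else K (q t), fun t => ?_, fun t => ?_, ?_, ?_⟩
  · by_cases ht : (t : ℝ) ≤ 1 / 2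
    · simpa only [if_pos ht, hle t ht] using h1 (p t)
    · simpa only [if_neg ht, hgt t ht] using k1 (q t)
  · have e1 : ∀ᶠ s in 𝓝 t, G (p s) =ᶠ[𝓝 (δ (p s))] G (p t) :=
      (hp.tendsto t).eventually (h2 (p t))
    have e2 : ∀ᶠ s in 𝓝 t, K (q s) =ᶠ[𝓝 (γ (q s))] K (q t) :=
      (hq.tendsto t).eventually (k2 (q t))
    rcases lt_trichotomy (t : ℝ) (1 / 2) with ht | ht | ht
    · have e3 : ∀ᶠ s : unitInterval in 𝓝 t, (s : ℝ) < 1 / 2 :=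
        (continuous_subtype_val.tendsto t).eventually (gt_mem_nhds ht)
      filter_upwards [e1, e3] with s hs1 hs3
      rw [hle s hs3.le, if_pos hs3.le, if_pos ht.le]
      exact hs1
    · have hp1 : p t = 1 := by
        apply Subtype.ext
        simp [p, ht, Set.projIcc]
      have hq0 : q t = 0 := by
        apply Subtype.ext
        simp [q, ht, Set.projIcc]
      have e4 : ∀ᶠ s in 𝓝 t, G 1 =ᶠ[𝓝 (γ (q s))] K 0 := by
        have hc : Tendsto (fun s => γ (q s)) (𝓝 t) (𝓝 0) := by
          have := ((γ.continuous.comp hq).tendsto t)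
          simpa [Function.comp_def, hq0] using this
        exact hc.eventually hGK.eventually_nhds
      filter_upwards [e1, e2, e4] with s hs1 hs2 hs4
      rw [if_pos ht.le, hp1]
      rw [hp1] at hs1
      rw [hq0] at hs2
      by_cases hs : (s : ℝ) ≤ 1 / 2
      · rw [hle s hs, if_pos hs]
        exact hs1
      · rw [hgt s hs, if_neg hs]
        exact hs2.trans hs4.symm
    · have e3 : ∀ᶠ s : unitInterval in 𝓝 t, 1 / 2 < (s : ℝ) :=
        (continuous_subtype_val.tendsto t).eventually (lt_mem_nhds ht)
      filter_upwards [e2, e3] with s hs2 hs3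
      rw [hgt s hs3.not_ge, if_neg hs3.not_ge, if_neg ht.not_ge]
      exact hs2
  · have : p 0 = 0 := by
      apply Subtype.ext
      simp [p, Set.projIcc]
    simpa [this] using h3
  · have : q 1 = 1 := by
      apply Subtype.ext
      norm_num [q, Set.projIcc]
    have h' : ¬ ((1 : unitInterval) : ℝ) ≤ 1 / 2 := by norm_num
    simpa only [if_neg h', this] using k4

/-- The monodromy group of a normalized `B`: the group of all permutations of the branches of
`B⁻¹` at `0` which are induced by analytic continuation along some loop based at `0` in the unit
disk minus the critical values of `B`. -/
def monodromyGroup (B : ℂ → ℂ) (hB : IsNormalized B) : Subgroup (Equiv.Perm (Branch B)) where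
  carrier := {σ | ∃ γ : Path (0 : ℂ) 0, IsAdmissibleLoop B γ ∧ ∀ φ, ContinuesAlong B γ φ (σ φ)}
  one_mem' := by
    refine ⟨Path.refl 0, fun t => ⟨by simp, ?_⟩, fun φ => ContinuesAlong.const φ⟩
    rintro ⟨z, ⟨hz, hz'⟩, h0⟩
    exact hB.simple_zeros z hz (by simpa using h0) hz'
  mul_mem' := by
    rintro σ τ ⟨γ, hγ, hσ⟩ ⟨δ, hδ, hτ⟩
    refine ⟨δ.trans γ, fun t => ?_, fun φ => (hτ φ).concat (hσ (τ φ))⟩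
    rw [Path.trans_apply]
    split_ifs
    · exact hδ _
    · exact hγ _
  inv_mem' := by
    rintro σ ⟨γ, hγ, hσ⟩
    refine ⟨γ.symm, fun t => hγ _, fun φ => ?_⟩
    have := (hσ (σ⁻¹ φ)).reverse
    simpa using this

/-! Let `w` be the critical value; it is nonzero because the zeros of `B` are simple. Postcomposing
with the disk automorphism `mobius w` gives a Blaschke product `F` of the same degree
(`IsBlaschkeProduct.mobius_comp`), all of whose critical points are zeros. Such an `F` has a single
zero, so `F = c * mobius b ^ n` (`IsBlaschkeProduct.exists_eq_pow`).

The single zero comes from the logarithmic derivative of `F`. Cleared of denominators, it is a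
polynomial `R` without zeros in the disk. On the unit circle, `z * logDeriv F z` is a positive sum
of Poisson kernels, so `R` does not vanish there, and symmetry under reflection in the circle
excludes zeros outside. Hence `R` is constant, and the exponent in the reflection formula leaves
room for only one zero.

In the coordinates `mobius b` on the source and `mobius w` on the target, `B` is therefore `x ↦ c *
x ^ n`. Branches at `0` correspond to the `n` roots of `c * x ^ n = -w`. Continuation is path
lifting, and two lifts of one loop have a constant ratio, so each loop multiplies all roots by a
common root of unity. A circle around the critical value yields a primitive one. -/

open scoped ComplexConjugate

/-! ### Disk automorphisms -/

/-- The automorphism of the unit disk sending `a` to `0`. -/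
noncomputable def mobius (a z : ℂ) : ℂ := (z - a) / (1 - conj a * z)

theorem one_sub_conj_mul_ne_zero {a z : ℂ} (ha : ‖a‖ < 1) (hz : ‖z‖ ≤ 1) :
    1 - conj a * z ≠ 0 := by
  intro h
  have h1 : ‖conj a * z‖ = 1 := by rw [← sub_eq_zero.mp h, norm_one]
  rw [norm_mul, RCLike.norm_conj] at h1
  nlinarith [norm_nonneg a, norm_nonneg z]

/-- The sign of the last product decides which of `‖z - a‖` and `‖1 - conj a * z‖` is larger; this
is used both inside and outside the disk. -/
theorem norm_sq_one_sub_conj_mul (a z : ℂ) :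
    ‖1 - conj a * z‖ ^ 2 = ‖z - a‖ ^ 2 + (1 - ‖a‖ ^ 2) * (1 - ‖z‖ ^ 2) := by
  simp only [← Complex.normSq_eq_norm_sq, Complex.normSq_apply]
  simp
  ring

theorem norm_mobius_lt_one {a z : ℂ} (ha : ‖a‖ < 1) (hz : ‖z‖ < 1) : ‖mobius a z‖ < 1 := by
  have h0 := one_sub_conj_mul_ne_zero ha hz.le
  rw [mobius, norm_div, div_lt_one (norm_pos_iff.mpr h0)]
  refine lt_of_pow_lt_pow_left₀ 2 (norm_nonneg _) ?_
  rw [norm_sq_one_sub_conj_mul]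
  have h1 : 0 < 1 - ‖a‖ ^ 2 := by nlinarith [norm_nonneg a]
  have h2 : 0 < 1 - ‖z‖ ^ 2 := by nlinarith [norm_nonneg z]
  nlinarith [mul_pos h1 h2]

theorem one_sub_conj_mul_self_ne_zero {a : ℂ} (ha : ‖a‖ < 1) : 1 - conj a * a ≠ 0 :=
  one_sub_conj_mul_ne_zero ha ha.le

theorem mobius_neg_mobius {a z : ℂ} (ha : ‖a‖ < 1) (hz : ‖z‖ < 1) :
    mobius (-a) (mobius a z) = z := by
  have h0 := one_sub_conj_mul_ne_zero ha hz.le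
  have h1 := one_sub_conj_mul_self_ne_zero ha
  have h2 : 1 - conj (-a) * ((z - a) / (1 - conj a * z)) = (1 - conj a * a) / (1 - conj a * z) := by
    rw [map_neg]
    field_simp
    ring
  have h3 : (z - a) / (1 - conj a * z) - -a = (1 - conj a * a) * z / (1 - conj a * z) := by
    rw [sub_neg_eq_add, eq_div_iff h0, add_mul, div_mul_cancel₀ _ h0]
    ring
  rw [mobius, mobius, h2, h3]
  field_simp

theorem mobius_mobius_neg {a z : ℂ} (ha : ‖a‖ < 1) (hz : ‖z‖ < 1) :
    mobius a (mobius (-a) z) = z := by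
  simpa using mobius_neg_mobius (a := -a) (by simpa using ha) hz

theorem mobius_self (a : ℂ) : mobius a a = 0 := by simp [mobius]

theorem mobius_eq_zero_iff {a z : ℂ} (ha : ‖a‖ < 1) (hz : ‖z‖ < 1) : mobius a z = 0 ↔ z = a := by
  rw [mobius, div_eq_zero_iff, or_iff_left (one_sub_conj_mul_ne_zero ha hz.le), sub_eq_zero]

theorem hasDerivAt_mobius {a z : ℂ} (h : 1 - conj a * z ≠ 0) :
    HasDerivAt (mobius a) ((1 - conj a * a) / (1 - conj a * z) ^ 2) z := by
  have h1 : HasDerivAt (fun z => z - a) 1 z := (hasDerivAt_id z).sub_const a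
  have h2 : HasDerivAt (fun z => 1 - conj a * z) (-conj a) z := by
    simpa using ((hasDerivAt_id z).const_mul (conj a)).const_sub 1
  refine (h1.div h2 h).congr_deriv ?_
  ring

theorem logDeriv_mobius {a z : ℂ} (h : 1 - conj a * z ≠ 0) (hz : z ≠ a) :
    logDeriv (mobius a) z = (1 - conj a * a) / ((z - a) * (1 - conj a * z)) := by
  have := sub_ne_zero.mpr hz
  rw [logDeriv_apply, (hasDerivAt_mobius h).deriv, mobius]
  field_simp

theorem analyticAt_mobius {a z : ℂ} (h : 1 - conj a * z ≠ 0) : AnalyticAt ℂ (mobius a) z :=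
  (analyticAt_id.sub analyticAt_const).div
    (analyticAt_const.sub (analyticAt_const.mul analyticAt_id)) h

/-! ### Finite Blaschke products -/

theorem IsBlaschkeProduct.iff_mobius {n : ℕ} {B : ℂ → ℂ} : IsBlaschkeProduct n B ↔
    ∃ (c : ℂ) (a : Fin n → ℂ), ‖c‖ = 1 ∧ (∀ j, ‖a j‖ < 1) ∧
      ∀ z ∈ Metric.ball (0 : ℂ) 1, B z = c * ∏ j, mobius (a j) z := Iff.rfl

theorem IsBlaschkeProduct.analyticAt {n : ℕ} {B : ℂ → ℂ} (hB : IsBlaschkeProduct n B) {z : ℂ}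
    (hz : z ∈ Metric.ball (0 : ℂ) 1) : AnalyticAt ℂ B z := by
  obtain ⟨c, a, -, ha, h⟩ := IsBlaschkeProduct.iff_mobius.mp hB
  have h1 : B =ᶠ[𝓝 z] fun z => c * ∏ j, mobius (a j) z :=
    eventually_of_mem (Metric.isOpen_ball.mem_nhds hz) h
  refine AnalyticAt.congr (analyticAt_const.mul ?_) h1.symm
  refine Finset.analyticAt_fun_prod _ fun j _ => analyticAt_mobius ?_
  exact one_sub_conj_mul_ne_zero (ha j) (mem_ball_zero_iff.mp hz).le

theorem IsBlaschkeProduct.norm_lt_one {n : ℕ} {B : ℂ → ℂ} (hB : IsBlaschkeProduct n B)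
    (hn : n ≠ 0) {z : ℂ} (hz : ‖z‖ < 1) : ‖B z‖ < 1 := by
  obtain ⟨c, a, hc, ha, h⟩ := IsBlaschkeProduct.iff_mobius.mp hB
  rw [h z (mem_ball_zero_iff.mpr hz), norm_mul, hc, one_mul, norm_prod]
  have : NeZero n := ⟨hn⟩
  rw [← Finset.mul_prod_erase _ _ (Finset.mem_univ (0 : Fin n))]
  refine mul_lt_one_of_nonneg_of_lt_one_left (norm_nonneg _) (norm_mobius_lt_one (ha 0) hz) ?_
  exact Finset.prod_le_one (fun _ _ => norm_nonneg _) fun j _ => (norm_mobius_lt_one (ha j) hz).le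

/-! ### Blaschke products whose critical points are zeros -/

open Polynomial in
/-- A weighted sum of the logarithmic derivatives of disk automorphisms with distinct zeros has
no zeros in the disk only if there is exactly one of them. -/
theorem card_eq_one_of_sum_logDeriv_ne_zero (S : Finset ℂ) (m : ℂ → ℝ) (hS : S.Nonempty)
    (hS1 : ∀ b ∈ S, ‖b‖ < 1) (hm : ∀ b ∈ S, 0 < m b)
    (h : ∀ z : ℂ, ‖z‖ < 1 → z ∉ S →
      ∑ b ∈ S, (m b : ℂ) * ((1 - conj b * b) / ((z - b) * (1 - conj b * z))) ≠ 0) :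
    S.card = 1 := by
  set q : ℂ → ℂ[X] := fun b => (X - C b) * (1 - C (conj b) * X) with hq
  have hqe : ∀ b z, (q b).eval z = (z - b) * (1 - conj b * z) := by simp [hq]
  set R : ℂ[X] := ∑ b ∈ S, C ((m b : ℂ) * (1 - conj b * b)) * ∏ b' ∈ S.erase b, q b' with hR
  have hRe : ∀ z, R.eval z =
      ∑ b ∈ S, (m b : ℂ) * (1 - conj b * b) * ∏ b' ∈ S.erase b, (q b').eval z := by
    intro z
    simp only [hR, eval_finsetSum, eval_mul, eval_C, eval_prod]
  have hfac : ∀ z, (∀ b ∈ S, (q b).eval z ≠ 0) → R.eval z =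
      (∑ b ∈ S, (m b : ℂ) * ((1 - conj b * b) / ((z - b) * (1 - conj b * z)))) *
        ∏ b ∈ S, (q b).eval z := by
    intro z hz
    rw [hRe, Finset.sum_mul]
    refine Finset.sum_congr rfl fun b hb => ?_
    rw [← Finset.mul_prod_erase _ _ hb, ← hqe]
    field_simp [hz b hb]
  -- Each `q b` is self-reciprocal of degree 2, the coefficients are real, and every product has
  -- `S.card - 1` factors.
  have hrefl : ∀ z, z ≠ 0 → R.eval z = z ^ (2 * (S.card - 1)) * conj (R.eval (conj z)⁻¹) := by
    intro z hz
    rw [hRe, hRe, map_sum, Finset.mul_sum]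
    refine Finset.sum_congr rfl fun b hb => ?_
    rw [pow_mul, ← Finset.card_erase_of_mem hb, map_mul, map_prod, mul_left_comm,
      ← Finset.prod_const, ← Finset.prod_mul_distrib]
    congr 1
    · simp [mul_comm]
    · refine Finset.prod_congr rfl fun b' _ => ?_
      rw [hqe, hqe]
      simp only [map_mul, map_sub, map_one, map_inv₀, Complex.conj_conj]
      field_simp
  have hin : ∀ z, ‖z‖ < 1 → R.eval z ≠ 0 := by
    intro z hz
    -- At a point of `S` only its own summand survives; elsewhere `R` is the nonvanishing sum times
    -- a nonzero product.
    by_cases hzS : z ∈ S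
    · rw [hRe, Finset.sum_eq_single z]
      · refine mul_ne_zero (mul_ne_zero ?_ (one_sub_conj_mul_self_ne_zero hz)) ?_
        · exact_mod_cast (hm z hzS).ne'
        · refine Finset.prod_ne_zero_iff.mpr fun b hb => ?_
          rw [Finset.mem_erase] at hb
          rw [hqe]
          exact mul_ne_zero (sub_ne_zero.mpr hb.1.symm)
            (one_sub_conj_mul_ne_zero (hS1 b hb.2) hz.le)
      · intro b _ hbz
        rw [Finset.prod_eq_zero (Finset.mem_erase.mpr ⟨hbz.symm, hzS⟩) (by simp [hqe]), mul_zero]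
      · exact fun h => absurd hzS h
    · have hne : ∀ b ∈ S, (q b).eval z ≠ 0 := by
        intro b hb
        rw [hqe]
        refine mul_ne_zero (sub_ne_zero.mpr ?_) (one_sub_conj_mul_ne_zero (hS1 b hb) hz.le)
        rintro rfl
        exact hzS hb
      rw [hfac z hne]
      exact mul_ne_zero (h z hz hzS) (Finset.prod_ne_zero_iff.mpr hne)
  have hon : ∀ z, ‖z‖ = 1 → R.eval z ≠ 0 := by
    intro z hz
    have hzz : z * conj z = 1 := by rw [Complex.mul_conj, Complex.normSq_eq_norm_sq, hz]; simp
    have hz0 : z ≠ 0 := by rintro rfl; simp at hz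
    have hzb : ∀ b ∈ S, z ≠ b := by rintro b hb rfl; exact (hS1 z hb).ne hz
    -- On the circle `1 - conj b * z = z * conj (z - b)`, which turns each summand into `z⁻¹` times
    -- a positive real number.
    have hqz : ∀ b, (z - b) * (1 - conj b * z) = z * ((‖z - b‖ ^ 2 : ℝ) : ℂ) := by
      intro b
      rw [← Complex.normSq_eq_norm_sq, ← Complex.mul_conj, map_sub]
      linear_combination (-(z - b)) * hzz
    have hne : ∀ b ∈ S, (q b).eval z ≠ 0 := by
      intro b hb
      rw [hqe]
      exact mul_ne_zero (sub_ne_zero.mpr (hzb b hb)) (one_sub_conj_mul_ne_zero (hS1 b hb) hz.le)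
    rw [hfac z hne]
    refine mul_ne_zero ?_ (Finset.prod_ne_zero_iff.mpr hne)
    have : ∑ b ∈ S, (m b : ℂ) * ((1 - conj b * b) / ((z - b) * (1 - conj b * z))) =
        z⁻¹ * ((∑ b ∈ S, m b * ((1 - ‖b‖ ^ 2) / ‖z - b‖ ^ 2) : ℝ) : ℂ) := by
      rw [Complex.ofReal_sum, Finset.mul_sum]
      refine Finset.sum_congr rfl fun b hb => ?_
      have : ((‖z - b‖ : ℝ) : ℂ) ≠ 0 := by
        exact_mod_cast (norm_pos_iff.mpr (sub_ne_zero.mpr (hzb b hb))).ne'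
      rw [hqz, mul_comm (conj b), Complex.mul_conj, Complex.normSq_eq_norm_sq]
      push_cast
      field_simp
    rw [this]
    refine mul_ne_zero (inv_ne_zero hz0) ?_
    refine Complex.ofReal_ne_zero.mpr (Finset.sum_pos (fun b hb => ?_) hS).ne'
    refine mul_pos (hm b hb) (div_pos ?_ ?_)
    · nlinarith [hS1 b hb, norm_nonneg b]
    · exact pow_pos (norm_pos_iff.mpr (sub_ne_zero.mpr (hzb b hb))) 2
  have hall : ∀ z, R.eval z ≠ 0 := by
    intro z
    rcases lt_trichotomy ‖z‖ 1 with hz | hz | hz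
    · exact hin z hz
    · exact hon z hz
    · have hz0 : z ≠ 0 := norm_pos_iff.mp (by linarith)
      rw [hrefl z hz0]
      refine mul_ne_zero (pow_ne_zero _ hz0) ((_root_.map_ne_zero _).mpr (hin _ ?_))
      rw [norm_inv, RCLike.norm_conj]
      exact inv_lt_one_of_one_lt₀ hz
  have hdeg : R.degree ≤ 0 := by
    by_contra hd
    obtain ⟨z, hz⟩ := Complex.exists_root (not_le.mp hd)
    exact hall z hz
  -- For constant `R`, the reflection formula at any point off the circle forces the exponent to be
  -- zero; `2` is such a point.
  have h2 := hrefl 2 two_ne_zero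
  have hr := hall 0
  rw [eq_C_of_degree_le_zero hdeg, eval_C, eval_C] at h2
  rw [eq_C_of_degree_le_zero hdeg, eval_C] at hr
  have h3 := congrArg norm h2
  rw [norm_mul, RCLike.norm_conj, norm_pow, Complex.norm_two] at h3
  have h4 : (2 : ℝ) ^ (2 * (S.card - 1)) = 1 :=
    mul_right_cancel₀ (norm_ne_zero_iff.mpr hr) (by rw [one_mul]; exact h3.symm)
  by_contra h5
  have h6 := hS.card_pos
  exact (one_lt_pow₀ (one_lt_two (α := ℝ)) (by omega : 2 * (S.card - 1) ≠ 0)).ne' h4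

/-- A finite Blaschke product whose critical points in the disk are among its zeros has only one
zero. -/
theorem IsBlaschkeProduct.exists_eq_pow {n : ℕ} {F : ℂ → ℂ} (hF : IsBlaschkeProduct n F)
    (hn : n ≠ 0) (hcrit : ∀ z : ℂ, ‖z‖ < 1 → deriv F z = 0 → F z = 0) :
    ∃ c b : ℂ, ‖c‖ = 1 ∧ ‖b‖ < 1 ∧ ∀ z : ℂ, ‖z‖ < 1 → F z = c * mobius b z ^ n := by
  classical
  obtain ⟨c, a, hc, ha, h⟩ := IsBlaschkeProduct.iff_mobius.mp hF
  have : NeZero n := ⟨hn⟩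
  have hc0 : c ≠ 0 := by rintro rfl; simp at hc
  set S : Finset ℂ := Finset.univ.image a with hS
  have hcard : S.card = 1 := by
    refine card_eq_one_of_sum_logDeriv_ne_zero S
      (fun b => ((Finset.univ.filter fun j => a j = b).card : ℝ)) ?_ ?_ ?_ ?_
    · exact Finset.univ_nonempty.image a
    · intro b hb
      obtain ⟨j, -, rfl⟩ := Finset.mem_image.mp hb
      exact ha j
    · intro b hb
      obtain ⟨j, -, rfl⟩ := Finset.mem_image.mp hb
      exact_mod_cast Finset.card_pos.mpr ⟨j, by simp⟩
    · intro z hz hzS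
      have hza : ∀ j, z ≠ a j := by
        rintro j rfl
        exact hzS (Finset.mem_image_of_mem _ (Finset.mem_univ j))
      have hd : ∀ j, 1 - conj (a j) * z ≠ 0 := fun j => one_sub_conj_mul_ne_zero (ha j) hz.le
      have hmz : ∀ j, mobius (a j) z ≠ 0 := fun j =>
        (mobius_eq_zero_iff (ha j) hz).not.mpr (hza j)
      have hFz : F z ≠ 0 := by
        rw [h z (mem_ball_zero_iff.mpr hz)]
        exact mul_ne_zero hc0 (Finset.prod_ne_zero_iff.mpr fun j _ => hmz j)
      have hlog : logDeriv F z =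
          ∑ j, (1 - conj (a j) * a j) / ((z - a j) * (1 - conj (a j) * z)) := by
        have h1 : F =ᶠ[𝓝 z] fun z => c * ∏ j, mobius (a j) z :=
          eventually_of_mem (Metric.isOpen_ball.mem_nhds (mem_ball_zero_iff.mpr hz)) h
        rw [(logDeriv_congr_nhds h1).self_of_nhds, logDeriv_const_mul _ _ hc0,
          logDeriv_prod (fun j _ => hmz j)
            fun j _ => (hasDerivAt_mobius (hd j)).differentiableAt]
        exact Finset.sum_congr rfl fun j _ => logDeriv_mobius (hd j) (hza j)
      -- Equal zeros are grouped, so that the weights are multiplicities.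
      have hsum := Finset.sum_comp (s := Finset.univ)
        (fun b : ℂ => (1 - conj b * b) / ((z - b) * (1 - conj b * z))) a
      rw [hsum] at hlog
      simp only [nsmul_eq_mul] at hlog
      simp only [Complex.ofReal_natCast]
      rw [hS, ← hlog, logDeriv_apply]
      exact div_ne_zero (fun h0 => hFz (hcrit z hz h0)) hFz
  obtain ⟨b, hb⟩ := Finset.card_eq_one.mp hcard
  have hab : ∀ j, a j = b := fun j => by
    have := Finset.mem_image_of_mem a (Finset.mem_univ j)
    rwa [← hS, hb, Finset.mem_singleton] at this
  refine ⟨c, b, hc, hab 0 ▸ ha 0, fun z hz => ?_⟩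
  rw [h z (mem_ball_zero_iff.mpr hz)]
  simp [hab]

/-! ### Postcomposition with a disk automorphism -/

/-- Reflection in the unit circle exchanges the factors `z - a` and `1 - conj a * z`, so a
factorization of a numerator yields one of the denominator. -/
theorem Finset.prod_one_sub_conj_mul {ι : Type*} (s : Finset ι) (a : ι → ℂ) {z : ℂ} (hz : z ≠ 0) :
    ∏ j ∈ s, (1 - conj (a j) * z) = z ^ s.card * conj (∏ j ∈ s, ((conj z)⁻¹ - a j)) := by
  rw [map_prod, ← Finset.prod_const, ← Finset.prod_mul_distrib]
  refine Finset.prod_congr rfl fun j _ => ?_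
  simp only [map_sub, map_inv₀, Complex.conj_conj]
  field_simp

theorem Multiset.exists_map_univ_val_eq {α : Type*} {s : Multiset α} {n : ℕ} (h : s.card = n) :
    ∃ b : Fin n → α, Multiset.map b Finset.univ.val = s := by
  subst h
  induction s using Quotient.inductionOn with
  | _ l => exact ⟨l.get, (Fin.univ_val_map l.get).trans (by rw [List.ofFn_get]; rfl)⟩

open Polynomial in
/-- Postcomposition with a disk automorphism preserves finite Blaschke products. -/
theorem IsBlaschkeProduct.mobius_comp {n : ℕ} {B : ℂ → ℂ} (hB : IsBlaschkeProduct n B)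
    {w : ℂ} (hw : ‖w‖ < 1) : IsBlaschkeProduct n fun z => mobius w (B z) := by
  obtain ⟨c, a, hc, ha, h⟩ := hB
  have hcc : c * conj c = 1 := by rw [Complex.mul_conj, Complex.normSq_eq_norm_sq, hc]; simp
  set P : ℂ[X] := ∏ j, (X - C (a j)) with hP
  set Q : ℂ[X] := ∏ j, (1 - C (conj (a j)) * X) with hQ
  have hPe : ∀ z, P.eval z = ∏ j, (z - a j) := by simp [hP, eval_prod]
  have hQe : ∀ z, Q.eval z = ∏ j, (1 - conj (a j) * z) := by simp [hQ, eval_prod]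
  have hPd : P.natDegree = n := by simp [hP, natDegree_prod_of_monic _ _ fun j _ => monic_X_sub_C (a j)]
  have hPm : P.Monic := monic_prod_of_monic _ _ fun j _ => monic_X_sub_C (a j)
  have hlin : ∀ j, (1 - C (conj (a j)) * X).natDegree ≤ 1 := fun j =>
    (natDegree_sub_le _ _).trans (by simpa using (natDegree_C_mul_le (conj (a j)) X).trans natDegree_X_le)
  have hQd : Q.natDegree ≤ n :=
    (natDegree_prod_le _ _).trans ((Finset.sum_le_sum fun j _ => hlin j).trans (by simp))
  have hQn : Q.coeff n = ∏ j, (-conj (a j)) := by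
    have := coeff_prod_of_natDegree_le (s := Finset.univ)
      (fun j => 1 - C (conj (a j)) * X) 1 (fun j _ => hlin j)
    simpa [coeff_one] using this
  -- With `B = c * P / Q`, this is the numerator of `B - w`. Its coefficient `k` in degree `n` is
  -- nonzero since `‖w‖ < 1 = ‖c‖`, so it has exactly `n` roots with multiplicity.
  set K : ℂ[X] := C c * P - C w * Q with hK
  set k : ℂ := c - w * ∏ j, (-conj (a j)) with hk
  have hKn : K.coeff n = k := by
    have : P.coeff n = 1 := by rw [← hPd]; exact hPm
    simp [hK, hk, hQn, this]
  have hk0 : k ≠ 0 := by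
    intro h0
    have h1 : ‖w * ∏ j, (-conj (a j))‖ = 1 := by rw [← sub_eq_zero.mp h0, hc]
    rw [norm_mul, norm_prod] at h1
    have h2 : ∏ j, ‖-conj (a j)‖ ≤ 1 :=
      Finset.prod_le_one (fun _ _ => norm_nonneg _) fun j _ => by simpa using (ha j).le
    nlinarith [norm_nonneg w]
  have hKd : K.natDegree = n := by
    refine natDegree_eq_of_le_of_coeff_ne_zero ?_ (by rwa [hKn])
    refine (natDegree_sub_le _ _).trans (max_le ?_ ?_)
    · exact (natDegree_C_mul_le _ _).trans hPd.le
    · exact (natDegree_C_mul_le _ _).trans hQd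
  have hKl : K.leadingCoeff = k := by rw [leadingCoeff, hKd, hKn]
  have hsplit : K.Splits := IsAlgClosed.splits K
  obtain ⟨b, hb⟩ := Multiset.exists_map_univ_val_eq (s := K.roots) (n := n)
    (by rw [← hsplit.natDegree_eq_card_roots, hKd])
  have hbK : ∀ z, K.eval z = k * ∏ j, (z - b j) := by
    intro z
    have h1 := congrArg (eval z) hsplit.eq_prod_roots
    rw [hKl] at h1
    rw [h1, eval_mul, eval_C, eval_multiset_prod, Multiset.map_map]
    congr 1
    rw [← hb, Multiset.map_map]
    simp [Finset.prod]
  have hroot : ∀ j, ‖b j‖ < 1 := by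
    intro j
    have h0 : K.eval (b j) = 0 := by
      rw [hbK, Finset.prod_eq_zero (Finset.mem_univ j) (sub_self _), mul_zero]
    by_contra! hle
    have h1 : ‖P.eval (b j)‖ = ‖w‖ * ‖Q.eval (b j)‖ := by
      rw [hK, eval_sub, sub_eq_zero] at h0
      simpa [hc] using congrArg norm h0
    -- Outside the open disk `Q` is dominated by `P`, which is incompatible with `‖P‖ = ‖w‖ * ‖Q‖`
    -- and `‖w‖ < 1`.
    have h2 : ‖Q.eval (b j)‖ ≤ ‖P.eval (b j)‖ := by
      rw [hPe, hQe, norm_prod, norm_prod]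
      refine Finset.prod_le_prod (fun _ _ => norm_nonneg _) fun i _ => ?_
      refine le_of_sq_le_sq ?_ (norm_nonneg _)
      rw [norm_sq_one_sub_conj_mul]
      nlinarith [ha i, norm_nonneg (a i), mul_nonneg
        (by nlinarith [ha i, norm_nonneg (a i)] : 0 ≤ 1 - ‖a i‖ ^ 2)
        (by nlinarith : 0 ≤ ‖b j‖ ^ 2 - 1)]
    have h3 : 0 < ‖P.eval (b j)‖ := by
      rw [norm_pos_iff, hPe]
      refine Finset.prod_ne_zero_iff.mpr fun i _ => sub_ne_zero.mpr ?_
      intro h4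
      exact (ha i).not_ge (h4 ▸ hle)
    nlinarith [norm_nonneg w]
  -- The denominator is `c` times the reflection of `K`, by `c * conj c = 1`. The origin has no
  -- reflected point and is computed directly.
  have hden : ∀ z, Q.eval z - conj w * (c * P.eval z) = c * conj k * ∏ j, (1 - conj (b j) * z) := by
    intro z
    rcases eq_or_ne z 0 with rfl | hz
    · rw [hPe, hQe, hk]
      simp only [map_sub, map_mul, map_prod, map_neg, Complex.conj_conj, mul_zero, sub_zero,
        zero_sub, Finset.prod_const_one, mul_one]
      linear_combination -hcc
    · have h1 := hbK (conj z)⁻¹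
      rw [hK] at h1
      simp only [eval_sub, eval_mul, eval_C] at h1
      rw [hPe, hQe] at h1 ⊢
      have h2 := congrArg conj h1
      simp only [map_sub, map_mul] at h2
      have h3 := Finset.prod_one_sub_conj_mul Finset.univ a hz
      have h4 := Finset.prod_one_sub_conj_mul Finset.univ b hz
      have h5 : ∏ j, (z - a j) =
          z ^ n * conj (∏ j, (1 - conj (a j) * (conj z)⁻¹)) := by
        have := Finset.prod_one_sub_conj_mul Finset.univ a (inv_ne_zero ((_root_.map_ne_zero conj).mpr hz))
        rw [this]
        simp only [map_inv₀, Complex.conj_conj, inv_inv, map_mul, map_pow, Finset.card_univ,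
          Fintype.card_fin]
        rw [← mul_assoc, ← mul_pow, mul_inv_cancel₀ hz, one_pow, one_mul]
      rw [h3, h4, h5, Finset.card_univ, Fintype.card_fin]
      linear_combination c * z ^ n * h2 - z ^ n * conj (∏ j, ((conj z)⁻¹ - a j)) * hcc
  refine ⟨k / (c * conj k), b, ?_, hroot, fun z hz => ?_⟩
  · rw [norm_div, norm_mul, hc, RCLike.norm_conj, one_mul, div_self (norm_ne_zero_iff.mpr hk0)]
  · have hz1 : ‖z‖ < 1 := mem_ball_zero_iff.mp hz
    have hQ0 : Q.eval z ≠ 0 := by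
      rw [hQe]
      exact Finset.prod_ne_zero_iff.mpr fun j _ => one_sub_conj_mul_ne_zero (ha j) hz1.le
    have hBz : B z = c * P.eval z / Q.eval z := by
      rw [h z hz, Finset.prod_div_distrib, ← hPe, ← hQe, mul_div_assoc]
    have hnum : B z - w = K.eval z / Q.eval z := by
      rw [hBz, hK]
      simp only [eval_sub, eval_mul, eval_C]
      field_simp
    have hdenz : 1 - conj w * B z = (Q.eval z - conj w * (c * P.eval z)) / Q.eval z := by
      rw [hBz]
      field_simp
    change (B z - w) / (1 - conj w * B z) = _
    rw [hnum, hdenz, div_div_div_cancel_right₀ hQ0, hden, hbK, Finset.prod_div_distrib, mul_div_mul_comm]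

/-! ### Local inverses -/

theorem exists_isLocalInverse {B : ℂ → ℂ} {z : ℂ} (hz : z ∈ Metric.ball (0 : ℂ) 1)
    (hB : AnalyticAt ℂ B z) (hB' : deriv B z ≠ 0) :
    ∃ g, IsLocalInverse B (B z) g ∧ g (B z) = z ∧ ∀ᶠ y in 𝓝 z, g (B y) = y := by
  have hval : hB.hasStrictDerivAt.localInverse _ _ _ hB' (B z) = z :=
    HasStrictFDerivAt.localInverse_apply_image ..
  refine ⟨hB.hasStrictDerivAt.localInverse _ _ _ hB',
    ⟨hB.analyticAt_localInverse hB', by rwa [hval], ?_⟩, hval, ?_⟩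
  · exact HasStrictDerivAt.eventually_right_inverse ..
  · exact HasStrictDerivAt.eventually_left_inverse ..

theorem IsLocalInverse.apply_eq {B g : ℂ → ℂ} {w : ℂ} (h : IsLocalInverse B w g) : B (g w) = w :=
  h.2.2.self_of_nhds

theorem IsLocalInverse.deriv_ne_zero {B g : ℂ → ℂ} {w : ℂ} (h : IsLocalInverse B w g)
    (hB : AnalyticAt ℂ B (g w)) : deriv B (g w) ≠ 0 := by
  intro h0
  have h1 : HasDerivAt (B ∘ g) (deriv B (g w) * deriv g w) w :=
    hB.differentiableAt.hasDerivAt.comp w h.1.differentiableAt.hasDerivAt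
  have h2 := h1.unique ((hasDerivAt_id w).congr_of_eventuallyEq h.2.2)
  rw [h0, zero_mul] at h2
  exact zero_ne_one h2

/-- Near the common value `B` has a left inverse, and applying it to `B (g₁ z) = z = B (g₂ z)`
identifies the germs. -/
theorem IsLocalInverse.eventuallyEq {B g₁ g₂ : ℂ → ℂ} {w : ℂ} (h₁ : IsLocalInverse B w g₁)
    (h₂ : IsLocalInverse B w g₂) (hB : AnalyticAt ℂ B (g₁ w)) (h : g₁ w = g₂ w) :
    g₁ =ᶠ[𝓝 w] g₂ := by
  obtain ⟨g, -, -, hg⟩ := exists_isLocalInverse h₁.2.1 hB (h₁.deriv_ne_zero hB)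
  filter_upwards [h₁.2.2, h₂.2.2, h₁.1.continuousAt.eventually hg,
    h₂.1.continuousAt.eventually (h ▸ hg)] with z e₁ e₂ e₃ e₄
  rw [← e₃, ← e₄, e₁, e₂]

/-! ### Branches as points of the fibre, continuation as path lifting -/

/-- The value of a branch at the base point. -/
noncomputable def Branch.value {B : ℂ → ℂ} (φ : Branch B) : ℂ := Germ.value φ.1

section

variable {B : ℂ → ℂ} (hB : ∀ z ∈ Metric.ball (0 : ℂ) 1, AnalyticAt ℂ B z)

theorem Branch.norm_value_lt_one (φ : Branch B) : ‖φ.value‖ < 1 := by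
  obtain ⟨g, hg, h⟩ := φ.2
  rw [Branch.value, h]
  exact mem_ball_zero_iff.mp hg.2.1

theorem Branch.map_value (φ : Branch B) : B φ.value = 0 := by
  obtain ⟨g, hg, h⟩ := φ.2
  rw [Branch.value, h]
  exact hg.apply_eq

include hB in
theorem Branch.value_injective : Function.Injective (Branch.value (B := B)) := by
  intro φ ψ h
  obtain ⟨g, hg, hφ⟩ := φ.2
  obtain ⟨k, hk, hψ⟩ := ψ.2
  rw [Branch.value, Branch.value, hφ, hψ] at h
  refine Subtype.ext ?_
  rw [hφ, hψ]
  exact Germ.coe_eq.mpr (hg.eventuallyEq hk (hB _ hg.2.1) h)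

include hB in
theorem Branch.exists_value_eq {z : ℂ} (hz : ‖z‖ < 1) (h0 : B z = 0) (hz' : deriv B z ≠ 0) :
    ∃ φ : Branch B, φ.value = z := by
  have hzb := mem_ball_zero_iff.mpr hz
  obtain ⟨g, hg, hgz, -⟩ := exists_isLocalInverse hzb (hB z hzb) hz'
  rw [h0] at hg hgz
  exact ⟨⟨g, g, hg, rfl⟩, hgz⟩

theorem ContinuesAlong.exists_lift {γ : Path (0 : ℂ) 0} {φ ψ : Branch B}
    (h : ContinuesAlong B γ φ ψ) :
    ∃ Γ : unitInterval → ℂ, Continuous Γ ∧ (∀ t, ‖Γ t‖ < 1) ∧ (∀ t, B (Γ t) = γ t) ∧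
      Γ 0 = φ.value ∧ Γ 1 = ψ.value := by
  obtain ⟨G, h1, h2, h3, h4⟩ := h
  refine ⟨fun t => G t (γ t), ?_, fun t => mem_ball_zero_iff.mp (h1 t).2.1,
    fun t => (h1 t).apply_eq, ?_, ?_⟩
  · refine continuous_iff_continuousAt.mpr fun t => ?_
    have hc : ContinuousAt (fun s => G t (γ s)) t :=
      ContinuousAt.comp (f := γ) (h1 t).1.continuousAt γ.continuous.continuousAt
    exact hc.congr ((h2 t).mono fun s hs => hs.self_of_nhds.symm)
  · simp [Branch.value, h3]
  · simp [Branch.value, h4]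

include hB in
theorem ContinuesAlong.of_lift {γ : Path (0 : ℂ) 0} {φ ψ : Branch B} {Γ : unitInterval → ℂ}
    (hΓ : Continuous Γ) (hΓ1 : ∀ t, ‖Γ t‖ < 1) (hΓB : ∀ t, B (Γ t) = γ t)
    (hΓ' : ∀ t, deriv B (Γ t) ≠ 0) (h0 : Γ 0 = φ.value) (h1 : Γ 1 = ψ.value) :
    ContinuesAlong B γ φ ψ := by
  have hb : ∀ t, Γ t ∈ Metric.ball (0 : ℂ) 1 := fun t => mem_ball_zero_iff.mpr (hΓ1 t)
  choose G hG hGΓ hGl using fun t => exists_isLocalInverse (hb t) (hB _ (hb t)) (hΓ' t)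
  simp only [hΓB] at hG hGΓ
  refine ⟨G, hG, fun t => ?_, ?_, ?_⟩
  · have e1 : ∀ᶠ s in 𝓝 t, G t (B (Γ s)) = Γ s := hΓ.continuousAt.eventually (hGl t)
    have e2 : ∀ᶠ s in 𝓝 t, AnalyticAt ℂ (G t) (γ s) :=
      γ.continuous.continuousAt.eventually (hG t).1.eventually_analyticAt
    have e3 : ∀ᶠ s in 𝓝 t, ∀ᶠ z in 𝓝 (γ s), B (G t z) = z :=
      γ.continuous.continuousAt.eventually (hG t).2.2.eventually_nhds
    filter_upwards [e1, e2, e3] with s h1 h2 h3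
    rw [hΓB] at h1
    have heq : G s (γ s) = G t (γ s) := by rw [hGΓ, h1]
    exact (hG s).eventuallyEq ⟨h2, h1 ▸ hb s, h3⟩ (hB _ (hG s).2.1) heq
  · obtain ⟨g, hg, h⟩ := φ.2
    rw [h]
    refine Germ.coe_eq.mpr (hg.eventuallyEq ?_ (hB _ hg.2.1) ?_)
    · simpa using hG 0
    · have := hGΓ 0
      rw [h0, Branch.value, h, γ.source] at this
      exact this.symm
  · obtain ⟨g, hg, h⟩ := ψ.2
    rw [h]
    refine Germ.coe_eq.mpr (hg.eventuallyEq ?_ (hB _ hg.2.1) ?_)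
    · simpa using hG 1
    · have := hGΓ 1
      rw [h1, Branch.value, h, γ.target] at this
      exact this.symm

end

/-! ### The power map normal form and its monodromy -/

/-- If two continuous functions on the unit interval have the same nonvanishing `n`-th powers,
then their ratio is constant. -/
theorem mul_eq_mul_of_pow_eq_pow {n : ℕ} (hn : n ≠ 0) {u v : unitInterval → ℂ}
    (hu : Continuous u) (hv : Continuous v) (hv0 : ∀ t, v t ≠ 0) (h : ∀ t, u t ^ n = v t ^ n) :
    u 1 * v 0 = u 0 * v 1 := by
  -- The ratio maps a connected space continuously into the finite, hence discrete, set of roots of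
  -- unity.
  have hfin : {x : ℂ | x ^ n = 1}.Finite := by
    refine ((Polynomial.nthRoots n (1 : ℂ)).toFinset.finite_toSet).subset fun x hx => ?_
    simpa [Polynomial.mem_nthRoots (Nat.pos_of_ne_zero hn)] using hx
  have hc : u 1 / v 1 = u 0 / v 0 := by
    refine isPreconnected_univ.constant_of_mapsTo (f := fun t => u t / v t) hfin.isDiscrete
      (hu.div hv hv0).continuousOn (fun t _ => ?_) (Set.mem_univ _) (Set.mem_univ _)
    change (u t / v t) ^ n = 1
    rw [div_pow, h, div_self (pow_ne_zero _ (hv0 t))]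
  rwa [div_eq_div_iff (hv0 1) (hv0 0)] at hc

/-- `mobius w` has nonvanishing derivative on the disk, so the critical points of the composite are
those of `B`; they lie over `w`, hence become zeros. -/
theorem exists_mobius_comp_eq_pow {n : ℕ} {B : ℂ → ℂ} (hB : IsBlaschkeProduct n B) (hn : n ≠ 0)
    {w : ℂ} (hw : ‖w‖ < 1) (hcrit : criticalValues B = {w}) :
    ∃ c b : ℂ, ‖c‖ = 1 ∧ ‖b‖ < 1 ∧ ∀ z : ℂ, ‖z‖ < 1 → mobius w (B z) = c * mobius b z ^ n := by
  refine (hB.mobius_comp hw).exists_eq_pow hn fun z hz h0 => ?_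
  have hd := one_sub_conj_mul_ne_zero hw (hB.norm_lt_one hn hz).le
  have hzb := mem_ball_zero_iff.mpr hz
  have h1 : HasDerivAt (fun z => mobius w (B z)) _ z :=
    (hasDerivAt_mobius hd).comp z (hB.analyticAt hzb).differentiableAt.hasDerivAt
  rw [h1.deriv, mul_eq_zero, or_iff_right
    (div_ne_zero (one_sub_conj_mul_self_ne_zero hw) (pow_ne_zero _ hd))] at h0
  have h2 : B z ∈ criticalValues B := ⟨z, ⟨hzb, h0⟩, rfl⟩
  rw [hcrit, Set.mem_singleton_iff] at h2
  change mobius w (B z) = 0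
  rw [h2, mobius_self]

theorem proposition5p2 (n : ℕ) (B : ℂ → ℂ) (hB : IsBlaschkeProduct n B) (hN : IsNormalized B)
    (hcrit : ∃ w : ℂ, criticalValues B = {w}) :
    Nat.card (Branch B) = n ∧
      IsCyclic (monodromyGroup B hN) ∧ Nat.card (monodromyGroup B hN) = n ∧
      ∃ σ : Equiv.Perm (Branch B), σ.IsCycle ∧ {φ : Branch B | σ φ ≠ φ}.ncard = n ∧
        monodromyGroup B hN = Subgroup.zpowers σ := by
  have hn : n ≠ 0 := by
    rintro rfl
    obtain ⟨c, a, hc, -, h⟩ := hB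
    have h0 := h 0 (by simp)
    rw [hN.map_zero] at h0
    have hc0 : c = 0 := by simpa using h0.symm
    simp [hc0] at hc
  obtain ⟨w, hcrit⟩ := hcrit
  have hBa : ∀ z ∈ Metric.ball (0 : ℂ) 1, AnalyticAt ℂ B z := fun z hz => hB.analyticAt hz
  obtain ⟨p, ⟨hp, hp'⟩, hpw⟩ : w ∈ criticalValues B := by rw [hcrit]; rfl
  have hw : ‖w‖ < 1 := hpw ▸ hB.norm_lt_one hn (mem_ball_zero_iff.mp hp)
  have hw0 : w ≠ 0 := by
    rintro rfl
    exact hN.simple_zeros p hp hpw hp'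
  have hnw : ‖-w‖ < 1 := by rwa [norm_neg]
  obtain ⟨c, b, hc, hb, hF⟩ := exists_mobius_comp_eq_pow hB hn hw hcrit
  have hc0 : c ≠ 0 := by rintro rfl; simp at hc
  have hnb : ‖-b‖ < 1 := by rwa [norm_neg]
  have hBe : ∀ z, ‖z‖ < 1 → B z = mobius (-w) (c * mobius b z ^ n) := fun z hz => by
    rw [← hF z hz, mobius_neg_mobius hw (hB.norm_lt_one hn hz)]
  have hw00 : mobius w 0 = -w := by simp [mobius]
  have hreg : ∀ z, ‖z‖ < 1 → B z ≠ w → deriv B z ≠ 0 := fun z hz hzw h0 => hzw <| by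
    have : B z ∈ criticalValues B := ⟨z, ⟨mem_ball_zero_iff.mpr hz, h0⟩, rfl⟩
    rwa [hcrit] at this
  -- In degree 1 there would be no critical point. This is what makes the generator move every
  -- branch.
  have hn1 : n ≠ 1 := by
    rintro rfl
    have h1 : HasDerivAt (fun z => mobius w (B z)) _ p :=
      (hasDerivAt_mobius (one_sub_conj_mul_ne_zero hw (hpw ▸ hw.le))).comp p
        (hBa p hp).differentiableAt.hasDerivAt
    rw [hp', mul_zero] at h1
    have hd := one_sub_conj_mul_ne_zero hb (mem_ball_zero_iff.mp hp).le
    have h2 := (hasDerivAt_mobius hd).const_mul c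
    have h3 : (fun z => mobius w (B z)) =ᶠ[𝓝 p] fun z => c * mobius b z :=
      eventually_of_mem (Metric.isOpen_ball.mem_nhds hp) fun z hz => by
        simpa using hF z (mem_ball_zero_iff.mp hz)
    exact mul_ne_zero hc0 (div_ne_zero (one_sub_conj_mul_self_ne_zero hb) (pow_ne_zero 2 hd))
      ((h2.congr_of_eventuallyEq h3).unique h1)
  -- The fibre over the base point in the new coordinates, where the base point `0` becomes `mobius
  -- w 0 = -w`.
  set A : Set ℂ := {x | x ^ n = -w / c} with hA
  have hAw : ∀ {x}, x ∈ A ↔ c * x ^ n = -w := fun {x} => by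
    rw [hA, Set.mem_ofPred_eq, eq_div_iff hc0, mul_comm]
  have ha0 : -w / c ≠ 0 := div_ne_zero (neg_ne_zero.mpr hw0) hc0
  have hA0 : ∀ {x}, x ∈ A → x ≠ 0 := fun {x} hx h0 => ha0 <| by
    rw [← (show x ^ n = -w / c from hx), h0, zero_pow hn]
  have hA1 : ∀ {x}, x ∈ A → ‖x‖ < 1 := fun {x} hx => by
    have h1 : ‖x‖ ^ n < 1 := by
      rw [← norm_pow, show x ^ n = -w / c from hx, norm_div, hc, div_one]
      exact hnw
    exact (pow_lt_one_iff_of_nonneg (norm_nonneg _) hn).mp h1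
  have hφA : ∀ φ : Branch B, mobius b φ.value ∈ A := fun φ => by
    rw [hAw, ← hF _ φ.norm_value_lt_one, φ.map_value, hw00]
  have hinj : Function.Injective fun φ : Branch B => (⟨mobius b φ.value, hφA φ⟩ : A) := by
    intro φ ψ h
    refine Branch.value_injective hBa ?_
    rw [← mobius_neg_mobius hb φ.norm_value_lt_one, ← mobius_neg_mobius hb ψ.norm_value_lt_one,
      show mobius b φ.value = mobius b ψ.value from congrArg Subtype.val h]
  have hsurj : Function.Surjective fun φ : Branch B => (⟨mobius b φ.value, hφA φ⟩ : A) := by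
    rintro ⟨x, hx⟩
    have hx1 := norm_mobius_lt_one hnb (hA1 hx)
    have hB0 : B (mobius (-b) x) = 0 := by
      rw [hBe _ hx1, mobius_mobius_neg hb (hA1 hx), hAw.mp hx, mobius_self]
    obtain ⟨φ, hφ⟩ := Branch.exists_value_eq hBa hx1 hB0 (hreg _ hx1 (by rw [hB0]; exact hw0.symm))
    exact ⟨φ, Subtype.ext <| show mobius b φ.value = x by
      rw [hφ, mobius_mobius_neg hb (hA1 hx)]⟩
  let e : Branch B ≃ A := Equiv.ofBijective _ ⟨hinj, hsurj⟩
  have hev : ∀ φ, ((e φ : A) : ℂ) = mobius b φ.value := fun _ => rfl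
  obtain ⟨ζ, hζ⟩ : ∃ ζ : ℂ, ζ = Complex.exp (2 * Real.pi * Complex.I / n) := ⟨_, rfl⟩
  have hprim : IsPrimitiveRoot ζ n := hζ ▸ Complex.isPrimitiveRoot_exp n hn
  have hcardA : Nat.card A = n := by
    have h1 : A = ((Polynomial.nthRoots n (-w / c)).toFinset : Set ℂ) := by
      ext x
      simp [hA, Polynomial.mem_nthRoots (Nat.pos_of_ne_zero hn)]
    rw [h1, Nat.card_coe_set_eq, Set.ncard_coe_finset,
      Multiset.toFinset_card_of_nodup (hprim.nthRoots_nodup ha0), hprim.card_nthRoots,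
      if_pos (IsAlgClosed.exists_pow_nat_eq _ (Nat.pos_of_ne_zero hn))]
  have hcard : Nat.card (Branch B) = n := (Nat.card_congr e).trans hcardA
  have hζA : ∀ {x}, x ∈ A → ζ * x ∈ A := fun {x} hx => by
    change (ζ * x) ^ n = -w / c
    rw [mul_pow, hprim.pow_eq_one, one_mul]
    exact hx
  have hζA' : ∀ {x}, x ∈ A → ζ⁻¹ * x ∈ A := fun {x} hx => by
    change (ζ⁻¹ * x) ^ n = -w / c
    rw [mul_pow, inv_pow, hprim.pow_eq_one, inv_one, one_mul]
    exact hx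
  have hζ0 : ζ ≠ 0 := hprim.ne_zero hn
  let rot : Equiv.Perm A :=
    { toFun := fun x => ⟨ζ * x, hζA x.2⟩
      invFun := fun x => ⟨ζ⁻¹ * x, hζA' x.2⟩
      left_inv := fun x => Subtype.ext (by simp [hζ0])
      right_inv := fun x => Subtype.ext (by simp [hζ0]) }
  let τ : Equiv.Perm (Branch B) := e.symm.permCongr rot
  have hτ : ∀ φ, mobius b (τ φ).value = ζ * mobius b φ.value := fun φ => by
    rw [← hev, ← hev]
    simp [τ, rot, Equiv.permCongr_apply]
  have hτk : ∀ (k : ℕ) φ, mobius b ((τ ^ k) φ).value = ζ ^ k * mobius b φ.value := by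
    intro k
    induction k with
    | zero => simp
    | succ k ih => intro φ; rw [pow_succ', Equiv.Perm.mul_apply, hτ, ih, pow_succ', mul_assoc]
  have hext : ∀ φ ψ : Branch B, mobius b φ.value = mobius b ψ.value → φ = ψ := fun φ ψ h =>
    hinj (Subtype.ext h)
  have hne : Nonempty (Branch B) := (Nat.card_pos_iff.mp (by omega)).1
  have hord : orderOf τ = n := by
    rw [hprim.eq_orderOf, orderOf_eq_orderOf_iff]
    intro k
    obtain ⟨φ⟩ := hne
    constructor
    · intro h
      have := hτk k φ
      rw [h, Equiv.Perm.one_apply] at this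
      exact (mul_eq_right₀ (hA0 (hφA φ))).mp this.symm
    · intro h
      refine Equiv.ext fun φ => hext _ _ ?_
      rw [hτk, h, one_mul, Equiv.Perm.one_apply]
  have hratio : ∀ {x y}, x ∈ A → y ∈ A → ∃ k : ℕ, ζ ^ k * x = y := by
    intro x y hx hy
    have : NeZero n := ⟨hn⟩
    obtain ⟨k, -, hk⟩ := hprim.eq_pow_of_pow_eq_one (ξ := y / x) (by
      rw [div_pow, show x ^ n = _ from hx, show y ^ n = _ from hy, div_self ha0])
    exact ⟨k, by rw [hk, div_mul_cancel₀ _ (hA0 hx)]⟩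
  have hτne : ∀ φ, τ φ ≠ φ := fun φ h => by
    have := hτ φ
    rw [h] at this
    exact hprim.ne_one (by omega) ((mul_eq_right₀ (hA0 (hφA φ))).mp this.symm)
  have hcyc : τ.IsCycle := by
    obtain ⟨φ⟩ := hne
    refine ⟨φ, hτne φ, fun ψ _ => ?_⟩
    obtain ⟨k, hk⟩ := hratio (hφA φ) (hφA ψ)
    exact ⟨k, hext _ _ (by rw [zpow_natCast, hτk, hk])⟩
  have hsub : monodromyGroup B hN ≤ Subgroup.zpowers τ := by
    rintro σ ⟨γ, hγ, hσ⟩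
    obtain ⟨φ₀⟩ := hne
    choose Γ hΓ hΓ1 hΓB hΓ0 hΓe using fun φ => (hσ φ).exists_lift
    obtain ⟨k, hk⟩ := hratio (hφA φ₀) (hφA (σ φ₀))
    have hcont : ∀ φ, Continuous fun t => mobius b (Γ φ t) := fun φ =>
      continuous_iff_continuousAt.mpr fun t => ContinuousAt.comp (f := Γ φ)
        (analyticAt_mobius (one_sub_conj_mul_ne_zero hb (hΓ1 φ t).le)).continuousAt
        (hΓ φ).continuousAt
    have hpow : ∀ φ t, c * mobius b (Γ φ t) ^ n = mobius w (γ t) := fun φ t => by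
      rw [← hF _ (hΓ1 φ t), hΓB]
    have hnz : ∀ φ t, mobius b (Γ φ t) ≠ 0 := fun φ t h0 => by
      have h1 := hpow φ t
      rw [h0, zero_pow hn, mul_zero, eq_comm,
        mobius_eq_zero_iff hw (mem_ball_zero_iff.mp (hγ t).1)] at h1
      exact (hγ t).2 (by rw [hcrit, h1]; rfl)
    refine Subgroup.mem_zpowers_iff.mpr ⟨k, Equiv.ext fun φ => hext _ _ ?_⟩
    -- The lifts from `φ` and `φ₀` have equal `n`-th powers, nonzero because the loop avoids `w`. So
    -- the factor `ζ ^ k` read off at `φ₀` serves every `φ`.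
    have h1 := mul_eq_mul_of_pow_eq_pow hn (hcont φ) (hcont φ₀) (hnz φ₀) fun t =>
      mul_left_cancel₀ hc0 ((hpow φ t).trans (hpow φ₀ t).symm)
    simp only [hΓ0, hΓe] at h1
    rw [zpow_natCast, hτk]
    refine mul_right_cancel₀ (hA0 (hφA φ₀)) ?_
    rw [h1, ← hk]
    ring
  have hmem : τ ∈ monodromyGroup B hN := by
    have hexp : ∀ s : ℝ, ‖Complex.exp (s * Complex.I)‖ = 1 := Complex.norm_exp_ofReal_mul_I
    have hcirc : ∀ t : unitInterval,
        ‖Complex.exp ((2 * Real.pi * t : ℝ) * Complex.I) * -w‖ < 1 := fun t => by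
      rwa [norm_mul, hexp, one_mul]
    -- In the coordinate `mobius w` this is the circle through `-w` centred at the origin, traversed
    -- once.
    let γ : Path (0 : ℂ) 0 :=
      { toFun := fun t => mobius (-w) (Complex.exp ((2 * Real.pi * t : ℝ) * Complex.I) * -w)
        continuous_toFun := continuous_iff_continuousAt.mpr fun t =>
          ContinuousAt.comp (g := mobius (-w)) (analyticAt_mobius
            (one_sub_conj_mul_ne_zero hnw (hcirc t).le)).continuousAt
            (Continuous.continuousAt (by fun_prop))
        source' := by simp [mobius_self]
        target' := by simp [mobius_self, Complex.exp_two_pi_mul_I] }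
    have hγ : ∀ t, γ t = mobius (-w) (Complex.exp ((2 * Real.pi * t : ℝ) * Complex.I) * -w) :=
      fun _ => rfl
    have hγw : ∀ t, γ t ≠ w := fun t h0 => by
      have h1 := mobius_mobius_neg hw (hcirc t)
      rw [← hγ, h0, mobius_self] at h1
      exact mul_ne_zero (Complex.exp_ne_zero _) (neg_ne_zero.mpr hw0) h1.symm
    refine ⟨γ, fun t => ⟨mem_ball_zero_iff.mpr (norm_mobius_lt_one hnw (hcirc t)), ?_⟩,
      fun φ => ?_⟩
    · rw [hcrit]
      exact hγw t
    have hx := hφA φ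
    have hrot : ∀ t : unitInterval,
        ‖Complex.exp ((2 * Real.pi * t / n : ℝ) * Complex.I) * mobius b φ.value‖ < 1 := fun t => by
      rw [norm_mul, hexp, one_mul]
      exact hA1 hx
    -- In the coordinate `mobius b` the lift makes one `n`-th of a turn, so it ends at `ζ` times its
    -- start.
    have hlift : ∀ t : unitInterval, B (mobius (-b)
        (Complex.exp ((2 * Real.pi * t / n : ℝ) * Complex.I) * mobius b φ.value)) = γ t :=
      fun t => by
        rw [hBe _ (norm_mobius_lt_one hnb (hrot t)), mobius_mobius_neg hb (hrot t), hγ, mul_pow,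
          mul_left_comm, hAw.mp hx, ← Complex.exp_nat_mul]
        congr 3
        have : (n : ℂ) ≠ 0 := Nat.cast_ne_zero.mpr hn
        push_cast
        field_simp
    refine ContinuesAlong.of_lift hBa (Γ := fun t => mobius (-b)
      (Complex.exp ((2 * Real.pi * t / n : ℝ) * Complex.I) * mobius b φ.value)) ?_
      (fun t => norm_mobius_lt_one hnb (hrot t)) hlift
      (fun t => hreg _ (norm_mobius_lt_one hnb (hrot t)) (by rw [hlift]; exact hγw t)) ?_ ?_
    · exact continuous_iff_continuousAt.mpr fun t =>
        ContinuousAt.comp (g := mobius (-b)) (analyticAt_mobius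
          (one_sub_conj_mul_ne_zero hnb (hrot t).le)).continuousAt
          (Continuous.continuousAt (by fun_prop))
    · simp [mobius_neg_mobius hb φ.norm_value_lt_one]
    · rw [← mobius_neg_mobius hb (τ φ).norm_value_lt_one, hτ, hζ]
      congr 3
      push_cast
      ring
  have hG : monodromyGroup B hN = Subgroup.zpowers τ :=
    le_antisymm hsub (Subgroup.zpowers_le.mpr hmem)
  refine ⟨hcard, ?_, ?_, τ, hcyc, ?_, hG⟩
  · rw [hG]
    infer_instance
  · rw [hG, Nat.card_zpowers, hord]
  · rw [show {φ : Branch B | τ φ ≠ φ} = Set.univ from Set.eq_univ_of_forall hτne, Set.ncard_univ, hcard]
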